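/- A composition is a finite sequence $\mathbf a=(a_1,\dots,a_r)$ of positive integers; it is admissible if $r=0$ or $a_1\ge 2$, and its weight is $|\mathbf a|=a_1+\dots+a_r$. Its binary word is $0^{a_1-1}1\cdots 0^{a_r-1}1$. The dual $\overline{\mathbf a}$ of an admissible composition $\mathbf a$ is the admissible composition whose word is obtained from that of $\mathbf a$ by reversing it and exchanging $0$ and $1$. Let $\mathcal A$ be the set of admissible compositions and $\mathcal B$ its quotient by the identification of $\mathbf a$ with $\overline{\mathbf a}$; the class of $\mathbf a$ is written $[\mathbf a]$. For $\mathbf a\in\mathcal A$ let $\mathbf a^{\rm init}$ be $\mathbf a$ with its last entry deleted ($\varnothing^{\rm init}=\varnothing$), let $\mathbf a^{\rm fin}$ be the dual of $\overline{\mathbf a}^{\,\rm init}$, and let $\mathbf a^{\rm mid}=(\mathbf a^{\rm fin})^{\rm init}$; extend ${\rm init}$ linearly to $\mathbf Z^{(\mathcal A)}$. Let $\delta:\mathbf Z^{(\mathcal B)}\to\mathbf Z^{(\mathcal A)}$ be the unique $\mathbf Z$-linear map, graded of degree $0$ for the weight, such that $\delta([\varnothing])=\varnothing$ and $$\delta([\mathbf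 a])^{\rm init}=\delta\big([\mathbf a^{\rm init}]+[\mathbf a^{\rm mid}]+[\mathbf a^{\rm fin}]\big)\qquad(\mathbf a\in\mathcal A,\ \mathbf a\neq\varnothing).$$ For a non-empty admissible composition $\mathbf a=(a_1,\dots,a_r)$ with binary word $\varepsilon_1\cdots\varepsilon_k$ and integers $m,n\ge 0$, put $$\zeta(\mathbf a)=\sum_{n_1>\dots>n_r>0}n_1^{-a_1}\cdots n_r^{-a_r},\qquad \sigma(\mathbf a)_n=\sum_{n_1>\dots>n_r>n}\binom{2n_1}{n_1}^{-1}n_1^{-a_1}\cdots n_r^{-a_r},\qquad \sigma(\mathbf a)=\sigma(\mathbf a)_0,$$ $$\zeta(\mathbf a)_{m,n}=\int_{1>t_1>\dots>t_k>0}(1-t_1)^m f_{\varepsilon_1}(t_1)\cdots f_{\varepsilon_k}(t_k)\,t_k^n\,dt_1\cdots dt_k,\qquad f_0(t)=\frac1t,\quad f_1(t)=\frac1{1-t}.$$ Theorem. Let $a\ge 2$ be an integer. Then $$\delta([a])=2\sum_{b=3}^{a}(b,\underbrace{1,\dots,1}_{a-b})+3\,(2,\underbrace{1,\dots,1}_{a-2}).$$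 Moreover the series defining $\zeta(a)$ and $\sigma(b,1,\dots,1)_n$ (with $a-b$ ones, $2\le b\le a$, $n\ge 0$) converge, and $$\zeta(a)=2\sum_{b=3}^{a}\sigma(b,\underbrace{1,\dots,1}_{a-b})+3\,\sigma(2,\underbrace{1,\dots,1}_{a-2}),$$ which for $a=2$ is Euler's identity $\zeta(2)=3\,\sigma(2)$. More generally, for every integer $n\ge 0$, $$\zeta(a)_{n,n}=\sum_{k>n}\binom{k+n}{n}^{-1}k^{-a}=2\sum_{b=3}^{a}\sigma(b,\underbrace{1,\dots,1}_{a-b})_n+3\,\sigma(2,\underbrace{1,\dots,1}_{a-2})_n.$$ -/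

import Mathlib

namespace AperyLike

/-- A composition is a finite list of positive integers; it is admissible if it is empty or its
first entry is at least `2`. -/
def IsAdmissible (l : List ℕ) : Prop :=
  (∀ x ∈ l, 1 ≤ x) ∧ ∀ x ∈ l.head?, 2 ≤ x

/-- The set `𝒜` of admissible compositions. -/
abbrev AdmComp : Type := {l : List ℕ // IsAdmissible l}

/-- The binary word `0^{a₁-1} 1 ⋯ 0^{a_r-1} 1` of a composition (`false` is `0`, `true` is `1`). -/
def word : List ℕ → List Bool
  | [] => []
  | x :: l => List.replicate (x - 1) false ++ true :: word l

/-- Reads off a composition from a binary word, `c` zeros having been read since the last `1`. -/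
def ofWordAux : ℕ → List Bool → List ℕ
  | _, [] => []
  | c, false :: w => ofWordAux (c + 1) w
  | c, true :: w => (c + 1) :: ofWordAux 0 w

/-- The composition with a given binary word (the inverse of `word` on words not ending in `0`). -/
def ofWord (w : List Bool) : List ℕ := ofWordAux 0 w

/-- The dual binary word: reverse the word and exchange `0` and `1`. -/
def dualWord (w : List Bool) : List Bool := w.reverse.map not

lemma ofWordAux_replicate (k : ℕ) (w : List Bool) : ∀ c,
    ofWordAux c (List.replicate k false ++ w) = ofWordAux (c + k) w := by
  induction k with
  | zero => intro c; simp
  | succ k ih =>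
    intro c
    simp only [List.replicate_succ, List.cons_append, ofWordAux, ih]
    congr 1; omega

lemma ofWord_word (l : List ℕ) (h : ∀ x ∈ l, 1 ≤ x) : ofWord (word l) = l := by
  induction l with
  | nil => rfl
  | cons x l ih =>
    have hx := h x (by simp)
    have := ih (fun y hy => h y (by simp [hy]))
    simp only [ofWord, word] at this ⊢
    rw [ofWordAux_replicate]
    simp only [ofWordAux, this]
    congr 1; omega

lemma word_ofWordAux (w : List Bool) : ∀ c, word (ofWordAux c (w ++ [true])) =
    List.replicate c false ++ (w ++ [true]) := by
  induction w with
  | nil => intro c; simp [ofWordAux, word]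
  | cons e w ih =>
    intro c
    cases e
    · simp only [List.cons_append, ofWordAux, ih, List.replicate_succ']
      simp
    · simp [ofWordAux, word, ih]

lemma ofWordAux_pos (w : List Bool) : ∀ c, ∀ x ∈ ofWordAux c w, 1 ≤ x := by
  induction w with
  | nil => intro c x hx; simp [ofWordAux] at hx
  | cons e w ih =>
    intro c x hx
    cases e
    · exact ih _ x hx
    · simp only [ofWordAux, List.mem_cons] at hx
      rcases hx with rfl | hx
      · omega
      · exact ih _ x hx

lemma ofWordAux_head (w : List Bool) : ∀ c, ∀ x ∈ (ofWordAux c w).head?, c + 1 ≤ x := by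
  induction w with
  | nil => intro c x hx; simp [ofWordAux] at hx
  | cons e w ih =>
    intro c x hx
    cases e
    · have := ih _ x hx; omega
    · simp [ofWordAux] at hx; omega

lemma word_append (l m : List ℕ) : word (l ++ m) = word l ++ word m := by
  induction l with
  | nil => rfl
  | cons x l ih => simp [word, ih]

lemma word_eq_of_admissible {l : List ℕ} (h : IsAdmissible l) (hl : l ≠ []) :
    ∃ w, word l = false :: (w ++ [true]) := by
  obtain ⟨x, m, rfl⟩ := List.exists_cons_of_ne_nil hl
  have hx : 2 ≤ x := h.2 x (by simp)
  obtain ⟨k, rfl⟩ : ∃ k, x = k + 2 := ⟨x - 2, by omega⟩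
  rcases List.eq_nil_or_concat m with rfl | ⟨m', y, rfl⟩
  · exact ⟨List.replicate k false, by simp [word, List.replicate_succ]⟩
  · refine ⟨List.replicate k false ++ true :: (word m' ++ List.replicate (y - 1) false), ?_⟩
    simp [word, word_append, List.replicate_succ]

lemma dualWord_dualWord (w : List Bool) : dualWord (dualWord w) = w := by
  simp [dualWord, List.map_reverse, Function.comp_def]

lemma word_ofWord_dualWord {l : List ℕ} (h : IsAdmissible l) :
    word (ofWord (dualWord (word l))) = dualWord (word l) := by
  by_cases hl : l = []
  · subst hl; rfl
  · obtain ⟨w, hw⟩ := word_eq_of_admissible h hl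
    have : dualWord (word l) = (false :: dualWord w) ++ [true] := by simp [hw, dualWord]
    rw [this, ofWord, word_ofWordAux]; simp

lemma admissible_dual {l : List ℕ} (h : IsAdmissible l) :
    IsAdmissible (ofWord (dualWord (word l))) := by
  refine ⟨ofWordAux_pos _ _, ?_⟩
  by_cases hl : l = []
  · subst hl; intro x hx; simp [word, dualWord, ofWord, ofWordAux] at hx
  · obtain ⟨w, hw⟩ := word_eq_of_admissible h hl
    have : dualWord (word l) = false :: (dualWord w ++ [true]) := by simp [hw, dualWord]
    rw [this, ofWord]
    exact ofWordAux_head _ 1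

lemma admissible_dropLast {l : List ℕ} (h : IsAdmissible l) : IsAdmissible l.dropLast := by
  refine ⟨fun x hx => h.1 x (List.mem_of_mem_dropLast hx), fun x hx => ?_⟩
  match l, h with
  | [], _ => simp at hx
  | [y], _ => simp at hx
  | y :: z :: m, h => exact h.2 x (by simpa using hx)

namespace AdmComp

/-- The empty composition `∅`. -/
def empty : AdmComp := ⟨[], by simp [IsAdmissible]⟩

/-- The weight of a composition. -/
def weight (a : AdmComp) : ℕ := a.1.sum

/-- The dual composition, whose binary word is dual to the word of `a`. -/
def dual (a : AdmComp) : AdmComp := ⟨ofWord (dualWord (word a.1)), admissible_dual a.2⟩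

/-- The initial part: delete the last entry. -/
def init (a : AdmComp) : AdmComp := ⟨a.1.dropLast, admissible_dropLast a.2⟩

/-- The final part: the dual of the initial part of the dual. -/
def fin (a : AdmComp) : AdmComp := a.dual.init.dual

/-- The middle part: the initial part of the final part. -/
def mid (a : AdmComp) : AdmComp := a.fin.init

/-- The admissible composition `(b, 1, …, 1)` with `c` entries `1` after `b ≥ 2`. -/
def consOnes (b c : ℕ) (hb : 2 ≤ b) : AdmComp :=
  ⟨b :: List.replicate c 1, by
    refine ⟨fun x hx => ?_, fun x hx => ?_⟩
    · rcases List.mem_cons.1 hx with rfl | hx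
      · omega
      · simp [(List.mem_replicate.1 hx).2]
    · simp at hx; omega⟩

/-- The admissible composition `(a)` of depth `1`, for `a ≥ 2`. -/
def depthOne (a : ℕ) (ha : 2 ≤ a) : AdmComp := ⟨[a], by simpa [IsAdmissible] using by omega⟩

lemma word_dual (a : AdmComp) : word a.dual.1 = dualWord (word a.1) := word_ofWord_dualWord a.2

lemma word_injective {a b : AdmComp} (h : word a.1 = word b.1) : a = b := by
  apply Subtype.ext
  rw [← ofWord_word a.1 a.2.1, h, ofWord_word b.1 b.2.1]

lemma dual_dual (a : AdmComp) : a.dual.dual = a :=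
  word_injective (by rw [word_dual, word_dual, dualWord_dualWord])

lemma length_word (l : List ℕ) (h : ∀ x ∈ l, 1 ≤ x) : (word l).length = l.sum := by
  induction l with
  | nil => rfl
  | cons x l ih =>
    have hx := h x (by simp)
    have := ih (fun y hy => h y (by simp [hy]))
    simp [word, this]; omega

lemma weight_dual (a : AdmComp) : a.dual.weight = a.weight := by
  rw [weight, weight, ← length_word _ a.dual.2.1, ← length_word _ a.2.1, word_dual]
  simp [dualWord]

lemma dual_ne_empty {a : AdmComp} (h : a ≠ empty) : a.dual ≠ empty := by
  intro h'
  apply h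
  rw [← dual_dual a, h']; rfl

lemma ne_nil {a : AdmComp} (h : a ≠ empty) : a.1 ≠ [] := fun h' => h (Subtype.ext h')

lemma two_le_weight {a : AdmComp} (h : a ≠ empty) : 2 ≤ a.weight := by
  obtain ⟨x, m, hm⟩ := List.exists_cons_of_ne_nil (ne_nil h)
  have := a.2.2 x (by simp [hm])
  simp [weight, hm]; omega

lemma exists_init_append {a : AdmComp} (h : a ≠ empty) :
    ∃ x, 1 ≤ x ∧ a.1 = a.init.1 ++ [x] :=
  ⟨a.1.getLast (ne_nil h), a.2.1 _ (List.getLast_mem _),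
    (List.dropLast_append_getLast (ne_nil h)).symm⟩

lemma weight_init_lt {a : AdmComp} (h : a ≠ empty) : a.init.weight < a.weight := by
  obtain ⟨x, hx, e⟩ := exists_init_append h
  have : a.weight = a.init.weight + x := by rw [weight, e]; simp [weight]
  omega

lemma weight_fin_lt {a : AdmComp} (h : a ≠ empty) : a.fin.weight < a.weight := by
  rw [fin, weight_dual, ← weight_dual a]
  exact weight_init_lt (dual_ne_empty h)

lemma weight_init_le (a : AdmComp) : a.init.weight ≤ a.weight := by
  by_cases h : a = empty
  · subst h; simp [init, empty, weight]
  · exact (weight_init_lt h).le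

lemma weight_mid_lt {a : AdmComp} (h : a ≠ empty) : a.mid.weight < a.weight :=
  (weight_init_le _).trans_lt (weight_fin_lt h)

/-- The explicit form of the final part, on lists. -/
def finList : List ℕ → List ℕ
  | [] => []
  | x :: l => if 3 ≤ x then (x - 1) :: l else l.dropWhile (· = 1)

lemma word_replicate_one_append (k : ℕ) (l : List ℕ) :
    word (List.replicate k 1 ++ l) = List.replicate k true ++ word l := by
  induction k with
  | zero => rfl
  | succ k ih => simp [List.replicate_succ, word, ih]

lemma dropWhile_one (k : ℕ) (l : List ℕ) (h : IsAdmissible l) :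
    (List.replicate k 1 ++ l).dropWhile (· = 1) = l := by
  induction k with
  | zero =>
    cases l with
    | nil => rfl
    | cons x l =>
      have := h.2 x (by simp)
      have hx : x ≠ 1 := by omega
      simp [hx]
  | succ k ih => simpa [List.replicate_succ] using ih

lemma fin_val (a : AdmComp) : a.fin.1 = finList a.1 := by
  by_cases h : a = empty
  · subst h; rfl
  obtain ⟨x, hx, e⟩ := exists_init_append (dual_ne_empty h)
  have hw : word a.1 = false :: (List.replicate (x - 1) true ++ word a.fin.1) := by
    have h1 : dualWord (word a.dual.1) = word a.1 := by rw [word_dual, dualWord_dualWord]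
    rw [← h1, e, word_append, fin, word_dual]
    simp [dualWord, word]
  generalize hc : a.fin = c at hw
  obtain ⟨k, rfl⟩ : ∃ k, x = k + 1 := ⟨x - 1, by omega⟩
  rcases k with _ | k
  · have hne : c.1 ≠ [] := by
      intro hcn
      obtain ⟨w, hw'⟩ := word_eq_of_admissible a.2 (ne_nil h)
      rw [hw', hcn] at hw
      simp [word] at hw
    obtain ⟨y, m, hm⟩ := List.exists_cons_of_ne_nil hne
    have hy : 2 ≤ y := c.2.2 y (by simp [hm])
    have h2 : word a.1 = word ((y + 1) :: m) := by
      rw [hw, hm]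
      obtain ⟨j, rfl⟩ : ∃ j, y = j + 1 := ⟨y - 1, by omega⟩
      simp [word, List.replicate_succ]
    have h3 : a.1 = (y + 1) :: m := by
      rw [← ofWord_word a.1 a.2.1, h2, ofWord_word]
      intro z hz
      rcases List.mem_cons.1 hz with rfl | hz
      · omega
      · exact c.2.1 z (by simp [hm, hz])
    rw [h3, hm, finList, if_pos (by omega)]; simp
  · have h2 : word a.1 = word (2 :: (List.replicate k 1 ++ c.1)) := by
      rw [hw]
      simp [word, List.replicate_succ, word_replicate_one_append]
    have h3 : a.1 = 2 :: (List.replicate k 1 ++ c.1) := by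
      rw [← ofWord_word a.1 a.2.1, h2, ofWord_word]
      intro z hz
      rcases List.mem_cons.1 hz with rfl | hz
      · omega
      · rcases List.mem_append.1 hz with hz | hz
        · simp [(List.mem_replicate.1 hz).2]
        · exact c.2.1 z hz
    rw [h3, finList, if_neg (by omega), dropWhile_one k _ c.2]

lemma dropLast_dropWhile (l : List ℕ) :
    (l.dropWhile (· = 1)).dropLast = l.dropLast.dropWhile (· = 1) := by
  induction l with
  | nil => rfl
  | cons x l ih =>
    by_cases hx : x = 1
    · subst hx
      cases l with
      | nil => simp
      | cons y l => simpa using ih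
    · cases l with
      | nil => simp [hx]
      | cons y l => simp [hx]

lemma fin_init (a : AdmComp) : a.init.fin = a.fin.init := by
  apply Subtype.ext
  rw [fin_val]
  change finList a.1.dropLast = a.fin.1.dropLast
  rw [fin_val]
  match a.1 with
  | [] => rfl
  | [x] =>
    by_cases hx : 3 ≤ x <;> simp [finList, hx]
  | x :: y :: l =>
    by_cases hx : 3 ≤ x
    · simp [finList, hx]
    · simp only [List.dropLast_cons_cons, finList, hx, if_false]
      exact (dropLast_dropWhile (y :: l)).symm

lemma init_dual (a : AdmComp) : a.dual.init = a.fin.dual := by rw [fin, dual_dual]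

lemma fin_dual (a : AdmComp) : a.dual.fin = a.init.dual := by rw [fin, dual_dual]

lemma mid_dual (a : AdmComp) : a.dual.mid = a.mid.dual := by
  rw [mid, fin_dual, init_dual, fin_init, mid]

/-- Two admissible compositions are identified when they are equal or dual to each other. -/
instance dualSetoid : Setoid AdmComp where
  r a b := b = a ∨ b = a.dual
  iseqv :=
    { refl := fun _ => Or.inl rfl
      symm := by
        rintro a b (rfl | rfl)
        · exact Or.inl rfl
        · exact Or.inr (dual_dual _).symm
      trans := by
        rintro a b c (rfl | rfl) (rfl | rfl)
        · exact Or.inl rfl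
        · exact Or.inr rfl
        · exact Or.inr rfl
        · exact Or.inl (dual_dual _) }

end AdmComp

open AdmComp

/-- The set `ℬ` of admissible compositions up to duality. -/
abbrev DualClass : Type := Quotient AdmComp.dualSetoid

/-- The basis element `[a]` of the free abelian group `ℤ^(ℬ)`. -/
noncomputable def cls (a : AdmComp) : DualClass →₀ ℤ := Finsupp.single (Quotient.mk _ a) 1

/-- The basis element `a` of the free abelian group `ℤ^(𝒜)`. -/
noncomputable def basis (a : AdmComp) : AdmComp →₀ ℤ := Finsupp.single a 1

/-- The `ℤ`-linear extension `ℓ ↦ ℓ^init` of the initial part to `ℤ^(𝒜)`. -/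
noncomputable def initMap : (AdmComp →₀ ℤ) →ₗ[ℤ] (AdmComp →₀ ℤ) :=
  Finsupp.lmapDomain ℤ ℤ AdmComp.init

/-- The properties that characterize the map `δ : ℤ^(ℬ) → ℤ^(𝒜)`: it is graded of degree `0` for
the weight, `δ([∅]) = ∅`, and `δ([a])^init = δ([a^init] + [a^mid] + [a^fin])` for every non-empty
admissible composition `a`. -/
structure IsDelta (δ : (DualClass →₀ ℤ) →ₗ[ℤ] (AdmComp →₀ ℤ)) : Prop where
  graded : ∀ a : AdmComp, ∀ b ∈ (δ (cls a)).support, b.weight = a.weight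
  map_empty : δ (cls AdmComp.empty) = basis AdmComp.empty
  map_init : ∀ a : AdmComp, a ≠ AdmComp.empty →
    initMap (δ (cls a)) = δ (cls a.init + cls a.mid + cls a.fin)

lemma append_admissible (b : AdmComp) (k : ℕ) (h : b.weight < k ∧ 2 ≤ k) :
    IsAdmissible (b.1 ++ [k - b.weight]) := by
  refine ⟨fun x hx => ?_, fun x hx => ?_⟩
  · rcases List.mem_append.1 hx with hx | hx
    · exact b.2.1 x hx
    · simp at hx; omega
  · by_cases hb : b.1 = []
    · have : b.weight = 0 := by simp [AdmComp.weight, hb]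
      simp [hb] at hx; omega
    · obtain ⟨y, m, hm⟩ := List.exists_cons_of_ne_nil hb
      simp only [hm, List.cons_append, List.head?_cons, Option.mem_some_iff] at hx
      exact b.2.2 x (by simp [hm, hx])

/-- Append an entry to `b` so as to reach weight `k` (no change when this is impossible). -/
def appendTo (k : ℕ) (b : AdmComp) : AdmComp :=
  if h : b.weight < k ∧ 2 ≤ k then ⟨b.1 ++ [k - b.weight], append_admissible b k h⟩ else b

lemma init_appendTo {k : ℕ} {b : AdmComp} (h : b.weight < k ∧ 2 ≤ k) :
    (appendTo k b).init = b := by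
  apply Subtype.ext
  simp [appendTo, h, AdmComp.init]

lemma weight_appendTo {k : ℕ} {b : AdmComp} (h : b.weight < k ∧ 2 ≤ k) :
    (appendTo k b).weight = k := by
  have h' := h.1
  rw [appendTo, dif_pos h]
  simp only [AdmComp.weight, List.sum_append, List.sum_singleton] at h' ⊢
  omega

open Classical in
/-- Auxiliary recursive construction of `δ([a])`. -/
noncomputable def deltaAux (a : AdmComp) : AdmComp →₀ ℤ :=
  if h : a = AdmComp.empty then basis AdmComp.empty
  else (deltaAux a.init + deltaAux a.mid + deltaAux a.fin).mapDomain (appendTo a.weight)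
termination_by a.weight
decreasing_by
  · exact weight_init_lt h
  · exact weight_mid_lt h
  · exact weight_fin_lt h

lemma deltaAux_empty : deltaAux AdmComp.empty = basis AdmComp.empty := by
  rw [deltaAux]; simp

lemma deltaAux_of_ne {a : AdmComp} (h : a ≠ AdmComp.empty) : deltaAux a =
    (deltaAux a.init + deltaAux a.mid + deltaAux a.fin).mapDomain (appendTo a.weight) := by
  rw [deltaAux]; simp [h]

lemma support_add3 {f g h : AdmComp →₀ ℤ} {b : AdmComp} (hb : b ∈ (f + g + h).support) :
    b ∈ f.support ∨ b ∈ g.support ∨ b ∈ h.support := by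
  classical
  rcases Finset.mem_union.1 (Finsupp.support_add hb) with hb | hb
  · rcases Finset.mem_union.1 (Finsupp.support_add hb) with hb | hb
    · exact Or.inl hb
    · exact Or.inr (Or.inl hb)
  · exact Or.inr (Or.inr hb)

lemma deltaAux_graded (k : ℕ) : ∀ a : AdmComp, a.weight = k →
    ∀ b ∈ (deltaAux a).support, b.weight = a.weight := by
  classical
  induction k using Nat.strong_induction_on with
  | _ k ih =>
    intro a hk b hb
    by_cases h : a = AdmComp.empty
    · subst h
      rw [deltaAux_empty, basis] at hb
      have := Finsupp.support_single_subset hb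
      rw [Finset.mem_singleton.1 this]
    · rw [deltaAux_of_ne h] at hb
      obtain ⟨c, hc, rfl⟩ := Finset.mem_image.1 (Finsupp.mapDomain_support hb)
      apply weight_appendTo
      refine ⟨?_, two_le_weight h⟩
      rcases support_add3 hc with hc | hc | hc
      · rw [ih _ (hk ▸ weight_init_lt h) _ rfl c hc]; exact weight_init_lt h
      · rw [ih _ (hk ▸ weight_mid_lt h) _ rfl c hc]; exact weight_mid_lt h
      · rw [ih _ (hk ▸ weight_fin_lt h) _ rfl c hc]; exact weight_fin_lt h

lemma deltaAux_init {a : AdmComp} (h : a ≠ AdmComp.empty) :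
    (deltaAux a).mapDomain AdmComp.init = deltaAux a.init + deltaAux a.mid + deltaAux a.fin := by
  rw [deltaAux_of_ne h, ← Finsupp.mapDomain_comp]
  conv_rhs => rw [← Finsupp.mapDomain_id (v := deltaAux a.init + deltaAux a.mid + deltaAux a.fin)]
  apply Finsupp.mapDomain_congr
  intro c hc
  apply init_appendTo
  refine ⟨?_, two_le_weight h⟩
  rcases support_add3 hc with hc | hc | hc
  · rw [deltaAux_graded _ _ rfl c hc]; exact weight_init_lt h
  · rw [deltaAux_graded _ _ rfl c hc]; exact weight_mid_lt h
  · rw [deltaAux_graded _ _ rfl c hc]; exact weight_fin_lt h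

lemma deltaAux_dual (k : ℕ) : ∀ a : AdmComp, a.weight = k → deltaAux a.dual = deltaAux a := by
  induction k using Nat.strong_induction_on with
  | _ k ih =>
    intro a hk
    by_cases h : a = AdmComp.empty
    · subst h; rfl
    · rw [deltaAux_of_ne (dual_ne_empty h), deltaAux_of_ne h, init_dual, fin_dual, mid_dual,
        weight_dual, ih _ (hk ▸ weight_init_lt h) a.init rfl,
        ih _ (hk ▸ weight_mid_lt h) a.mid rfl, ih _ (hk ▸ weight_fin_lt h) a.fin rfl]
      congr 1; abel

theorem existsUnique_isDelta :
    ∃! δ : (DualClass →₀ ℤ) →ₗ[ℤ] (AdmComp →₀ ℤ), IsDelta δ := by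
  classical
  let D : DualClass → (AdmComp →₀ ℤ) := Quotient.lift deltaAux (by
    rintro a b (rfl | rfl)
    · rfl
    · exact (deltaAux_dual _ a rfl).symm)
  have hD : ∀ a, Finsupp.linearCombination ℤ D (cls a) = deltaAux a := by
    intro a; simp [cls, D]
  refine ⟨Finsupp.linearCombination ℤ D, ⟨?_, ?_, ?_⟩, ?_⟩
  · intro a b hb
    rw [hD] at hb
    exact deltaAux_graded _ a rfl b hb
  · rw [hD, deltaAux_empty]
  · intro a h
    rw [map_add, map_add, hD, hD, hD, hD]
    exact deltaAux_init h
  · intro δ hδ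
    have key : ∀ k, ∀ a : AdmComp, a.weight = k → δ (cls a) = deltaAux a := by
      intro k
      induction k using Nat.strong_induction_on with
      | _ k ih =>
        intro a hk
        by_cases h : a = AdmComp.empty
        · subst h; rw [hδ.map_empty, deltaAux_empty]
        · have h1 := hδ.map_init a h
          rw [map_add, map_add, ih _ (hk ▸ weight_init_lt h) a.init rfl,
            ih _ (hk ▸ weight_mid_lt h) a.mid rfl, ih _ (hk ▸ weight_fin_lt h) a.fin rfl,
            ← deltaAux_init h] at h1
          have hinj : Set.InjOn AdmComp.init {b : AdmComp | b.weight = a.weight} := by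
            intro b hb c hc hbc
            have h2 := two_le_weight h
            have hb0 : b ≠ AdmComp.empty := by
              rintro rfl; simp [AdmComp.empty, AdmComp.weight] at hb h2; omega
            have hc0 : c ≠ AdmComp.empty := by
              rintro rfl; simp [AdmComp.empty, AdmComp.weight] at hc h2; omega
            obtain ⟨x, -, ex⟩ := exists_init_append hb0
            obtain ⟨y, -, ey⟩ := exists_init_append hc0
            have hw : b.weight = c.weight := by
              simp only [Set.mem_ofPred_eq] at hb hc; omega
            have hbw : b.weight = b.init.weight + x := by
              rw [AdmComp.weight, ex]; simp [AdmComp.weight]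
            have hcw : c.weight = c.init.weight + y := by
              rw [AdmComp.weight, ey]; simp [AdmComp.weight]
            rw [hbc] at hbw
            have hxy : x = y := by omega
            apply Subtype.ext
            rw [ex, ey, hbc, hxy]
          refine Finsupp.mapDomain_injOn _ hinj ?_ ?_ h1
          · intro b hb; exact hδ.graded a b hb
          · intro b hb; exact deltaAux_graded _ a rfl b hb
    apply Finsupp.lhom_ext'
    intro q
    induction q using Quotient.inductionOn with
    | _ a =>
      apply LinearMap.ext_ring
      have := (key _ a rfl).trans (hD a).symm
      simpa [cls] using this

/-- The map `δ : ℤ^(ℬ) → ℤ^(𝒜)`: the unique `ℤ`-linear map with the properties `IsDelta`. -/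
noncomputable def delta : (DualClass →₀ ℤ) →ₗ[ℤ] (AdmComp →₀ ℤ) :=
  existsUnique_isDelta.choose

theorem isDelta_delta : IsDelta delta := existsUnique_isDelta.choose_spec.1

/-- The tuples `n₁ > ⋯ > n_r > n` of natural numbers. -/
abbrev DecrTuple (r n : ℕ) : Type := {v : Fin r → ℕ // StrictAnti v ∧ ∀ i, n < v i}

/-- `n₁^{-a₁} ⋯ n_r^{-a_r}`. -/
noncomputable def zetaTerm (a : List ℕ) (v : Fin a.length → ℕ) : ℝ :=
  ∏ i, ((v i : ℝ) ^ a.get i)⁻¹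

/-- The multiple zeta value `ζ(a)`, the sum of `n₁^{-a₁} ⋯ n_r^{-a_r}` over `n₁ > ⋯ > n_r > 0`. -/
noncomputable def mzv (a : List ℕ) : ℝ :=
  ∑' v : DecrTuple a.length 0, zetaTerm a v.1

/-- `binom(2n₁, n₁)⁻¹ n₁^{-a₁} ⋯ n_r^{-a_r}`, for the non-empty composition `a₁ :: l`. -/
noncomputable def aperyTerm (a₁ : ℕ) (l : List ℕ) (v : Fin (l.length + 1) → ℕ) : ℝ :=
  (Nat.centralBinom (v 0) : ℝ)⁻¹ * zetaTerm (a₁ :: l) v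

/-- The `n`-tail `σ(a)_n` of the multiple Apéry-like sum: the sum of
`binom(2n₁, n₁)⁻¹ n₁^{-a₁} ⋯ n_r^{-a_r}` over `n₁ > ⋯ > n_r > n`, with
`σ(∅)_n = binom(2n, n)⁻¹`. -/
noncomputable def aperyTail (a : List ℕ) (n : ℕ) : ℝ :=
  match a with
  | [] => (Nat.centralBinom n : ℝ)⁻¹
  | a₁ :: l => ∑' v : DecrTuple (l.length + 1) n, aperyTerm a₁ l v.1

/-- The multiple Apéry-like sum `σ(a)`, with `σ(∅) = 1`. -/
noncomputable def aperySum (a : List ℕ) : ℝ := aperyTail a 0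

/-- The functions `f₀(t) = 1 / t` and `f₁(t) = 1 / (1 - t)`. -/
noncomputable def form : Bool → ℝ → ℝ
  | false, t => 1 / t
  | true, t => 1 / (1 - t)

/-- The iterated integral `∫_{x > t₁ > ⋯ > t_k > 0} f_{ε₁}(t₁) ⋯ f_{ε_k}(t_k) t_kⁿ dt₁ ⋯ dt_k`
of a non-empty word `ε₁ ⋯ ε_k`, computed from the outermost variable; the value `xⁿ` on the empty
word provides the factor `t_kⁿ` of the innermost form. -/
noncomputable def iterInt (n : ℕ) : List Bool → ℝ → ℝ
  | [], x => x ^ n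
  | e :: w, x => ∫ t in (0 : ℝ)..x, form e t * iterInt n w t

/-- The double tail `ζ(a)_{m,n}`, the iterated integral
`∫_{1 > t₁ > ⋯ > t_k > 0} (1 - t₁)^m f_{ε₁}(t₁) ⋯ f_{ε_k}(t_k) t_kⁿ dt₁ ⋯ dt_k`, where `ε₁ ⋯ ε_k`
is the binary word of `a`; for the empty composition it is `binom(m + n, m)⁻¹`. -/
noncomputable def zetaDoubleTail (a : List ℕ) (m n : ℕ) : ℝ :=
  match word a with
  | [] => ((m + n).choose m : ℝ)⁻¹
  | e :: w => ∫ t in (0 : ℝ)..1, (1 - t) ^ m * form e t * iterInt n w t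

end AperyLike

namespace AperyLike

/-! Write D_a(n) for `diagTail a n`, the sum over k > n of binom(k+n, n)⁻¹ k^{-a}. Since (k+n+1)
binom(k+n, n) = (n+1) binom(k+n+1, n+1), passing from n to n+1 in a term costs only a term of
exponent one less divided by n+1. Summed over k, with the initial term k = n+1 split off, this gives
`diagTail_succ`: D_{a+1}(n) - D_{a+1}(n+1) = 2 binom(2n+2, n+1)⁻¹ (n+1)^{-a-1} + (n+1)⁻¹ D_a(n+1).
For a = 1 the last sum telescopes (`diagTail_one`) and equals half of the first contribution, so the
coefficient becomes 3.

The tails of the Apéry-like sums, written as iterated sums `nestedTail`, obey the matching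
recursion: the difference in n of the sum for (b, 1, …, 1) is (n+1)⁻¹ times the sum with one 1
fewer, or a single term for (b). Both sides tend to 0 as n grows, so equal differences force
equality, and `diagTail_eq` follows by induction on a.

It remains to recognize the two sides. Expanding the iterated integral in powers of t and using the
Beta integral identifies ζ(a)_{n,n} with D_a(n) (`hasSum_zetaDoubleTail`); fibring decreasing tuples
over their smallest entry identifies σ(b, 1, …, 1)_n with the nested sum (`hasSum_onesTerm`).

The formula for δ has the same source (`delta_depthOne`): for a ≥ 3 the init and mid parts of (a)
are empty and its final part is (a-1), while for a = 2 all three parts are empty. -/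

open Filter Topology

/-! ### Tails of the series `∑ binom(k + n, n)⁻¹ k^{-a}` -/

/-- The term `binom(k + n, n)⁻¹ k^{-a}`. -/
noncomputable def diagTerm (a n k : ℕ) : ℝ := (((k + n).choose n : ℝ) * (k : ℝ) ^ a)⁻¹

/-- The series `∑_{k > n} binom(k + n, n)⁻¹ k^{-a}`. -/
noncomputable def diagTail (a n : ℕ) : ℝ := ∑' j : ℕ, diagTerm a n (n + 1 + j)

lemma diagTerm_nonneg (a n k : ℕ) : 0 ≤ diagTerm a n k := by
  unfold diagTerm; positivity

lemma le_choose_add (k n : ℕ) : k ≤ (k + (n + 1)).choose (n + 1) := by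
  have h : (k + 1).choose k ≤ (k + (n + 1)).choose k := Nat.choose_le_choose k (by omega)
  rw [Nat.choose_symm_add] at h
  simp only [Nat.choose_one_right] at h
  rw [Nat.choose_symm_add] at h
  omega

/-- When the exponent is only 1, the binomial coefficient, at least k once n ≥ 1, supplies the
missing power of k. -/
lemma diagTerm_le {a n k : ℕ} (hk : 1 ≤ k) (h : 2 ≤ a ∨ 1 ≤ a ∧ 1 ≤ n) :
    diagTerm a n k ≤ 1 / (k : ℝ) ^ 2 := by
  have hk' : (1 : ℝ) ≤ k := by exact_mod_cast hk
  rw [diagTerm, one_div]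
  apply inv_anti₀ (by positivity)
  rcases h with h | ⟨h, hn⟩
  · have h1 : (1 : ℝ) ≤ ((k + n).choose n : ℝ) := by
      exact_mod_cast Nat.choose_pos (Nat.le_add_left n k)
    calc (k : ℝ) ^ 2 = 1 * (k : ℝ) ^ 2 := by ring
      _ ≤ _ := mul_le_mul h1 (pow_le_pow_right₀ hk' h) (by positivity) (by positivity)
  · obtain ⟨m, rfl⟩ : ∃ m, n = m + 1 := ⟨n - 1, by omega⟩
    have h1 : (k : ℝ) ≤ ((k + (m + 1)).choose (m + 1) : ℝ) := by
      exact_mod_cast le_choose_add k m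
    calc (k : ℝ) ^ 2 = k * (k : ℝ) ^ 1 := by ring
      _ ≤ _ := mul_le_mul h1 (pow_le_pow_right₀ hk' h) (by positivity) (by positivity)

lemma summable_one_div_sq_add (n : ℕ) :
    Summable fun j : ℕ => 1 / ((n + 1 + j : ℕ) : ℝ) ^ 2 := by
  have h := (summable_nat_add_iff (n + 1)).2
    (Real.summable_one_div_nat_pow.2 (one_lt_two : 1 < 2))
  simpa only [add_comm] using h

lemma summable_diagTerm {a n : ℕ} (h : 2 ≤ a ∨ 1 ≤ a ∧ 1 ≤ n) :
    Summable fun j : ℕ => diagTerm a n (n + 1 + j) :=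
  (summable_one_div_sq_add n).of_nonneg_of_le (fun _ => diagTerm_nonneg _ _ _)
    fun _ => diagTerm_le (by omega) h

lemma tendsto_diagTail {a : ℕ} (ha : 2 ≤ a) : Tendsto (diagTail a) atTop (𝓝 0) := by
  have h := (tendsto_sum_nat_add fun k : ℕ => 1 / (k : ℝ) ^ 2).comp (tendsto_add_atTop_nat 1)
  refine squeeze_zero (fun n => tsum_nonneg fun _ => diagTerm_nonneg _ _ _) (fun n => ?_) h
  have : (fun k : ℕ => 1 / ((k + (n + 1) : ℕ) : ℝ) ^ 2) =
      fun j : ℕ => 1 / ((n + 1 + j : ℕ) : ℝ) ^ 2 := by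
    funext j; rw [add_comm]
  simp only [Function.comp_apply, this]
  exact (summable_diagTerm (Or.inl ha)).tsum_le_tsum (fun _ => diagTerm_le (by omega) (Or.inl ha))
    (summable_one_div_sq_add n)

/-- Since (k+n+1) binom(k+n, n) = (n+1) binom(k+n+1, n+1), the quotient of the two binomial
coefficients is 1 + k/(n+1), and its summands give the two terms. -/
lemma diagTerm_sub (a n k : ℕ) (hk : 1 ≤ k) :
    diagTerm (a + 1) n k = diagTerm (a + 1) (n + 1) k + ((n + 1 : ℕ) : ℝ)⁻¹ *
      diagTerm a (n + 1) k := by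
  have h : ((k + n + 1 : ℕ) : ℝ) * ((k + n).choose n : ℝ) =
      ((k + (n + 1)).choose (n + 1) : ℝ) * ((n + 1 : ℕ) : ℝ) := by
    exact_mod_cast Nat.add_one_mul_choose_eq (k + n) n
  have h1 : ((k + n).choose n : ℝ) ≠ 0 := by
    exact_mod_cast (Nat.choose_pos (Nat.le_add_left n k)).ne'
  have h2 : ((k + (n + 1)).choose (n + 1) : ℝ) ≠ 0 := by
    exact_mod_cast (Nat.choose_pos (Nat.le_add_left (n + 1) k)).ne'
  have hk' : (k : ℝ) ≠ 0 := by exact_mod_cast (by omega : k ≠ 0)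
  have hn : ((n : ℝ) + 1) ≠ 0 := by positivity
  unfold diagTerm
  push_cast at h ⊢
  generalize ((k + n).choose n : ℝ) = C at *
  generalize ((k + (n + 1)).choose (n + 1) : ℝ) = D at *
  field_simp
  linear_combination (-(k : ℝ) ^ a) * h

/-- binom(2n+1, n) is half of binom(2n+2, n+1). This is the origin of the coefficient 2 in the
theorem. -/
lemma diagTerm_self (a n : ℕ) :
    diagTerm a n (n + 1) =
      2 * ((Nat.centralBinom (n + 1) : ℝ) * ((n + 1 : ℕ) : ℝ) ^ a)⁻¹ := by
  have h : (2 * (n + 1) : ℝ) * ((n + 1 + n).choose n : ℝ) =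
      (Nat.centralBinom (n + 1) : ℝ) * (n + 1) := by
    have := Nat.add_one_mul_choose_eq (n + 1 + n) n
    rw [Nat.centralBinom, show 2 * (n + 1) = n + 1 + n + 1 by ring]
    exact_mod_cast (by rw [← this]; ring)
  have hn : ((n : ℝ) + 1) ≠ 0 := by positivity
  have h' : (Nat.centralBinom (n + 1) : ℝ) = 2 * ((n + 1 + n).choose n : ℝ) := by
    apply mul_right_cancel₀ hn
    rw [← h]; ring
  rw [diagTerm, h', mul_assoc, mul_inv 2, mul_inv_cancel_left₀ two_ne_zero]

/-- The tail at n starts at k = n+1, the tails at n+1 start at k = n+2: the term k = n+1 is isolated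
by `diagTerm_self`, and `diagTerm_sub` applies to the others. -/
lemma diagTail_succ {a : ℕ} (ha : 1 ≤ a) (n : ℕ) :
    diagTail (a + 1) n = 2 * ((Nat.centralBinom (n + 1) : ℝ) * ((n + 1 : ℕ) : ℝ) ^ (a + 1))⁻¹ +
      diagTail (a + 1) (n + 1) + ((n + 1 : ℕ) : ℝ)⁻¹ * diagTail a (n + 1) := by
  have h1 := summable_diagTerm (a := a + 1) (n := n + 1) (Or.inl (by omega))
  have h2 := summable_diagTerm (a := a) (n := n + 1) (Or.inr ⟨ha, by omega⟩)
  rw [diagTail, (summable_diagTerm (Or.inl (by omega))).tsum_eq_zero_add, add_zero, diagTerm_self,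
    add_assoc, diagTail, diagTail, ← tsum_mul_left, ← h1.tsum_add (h2.mul_left _)]
  congr 1
  apply tsum_congr
  intro j
  rw [show n + 1 + (j + 1) = n + 1 + 1 + j by ring, diagTerm_sub _ _ _ (by omega)]

lemma diagTail_one (n : ℕ) :
    diagTail 1 (n + 1) = ((Nat.centralBinom (n + 1) : ℝ) * ((n + 1 : ℕ) : ℝ))⁻¹ := by
  -- A discrete primitive of the terms. Its value at the first index k = n+2 involves binom(2n+2,
  -- n+1), a central coefficient.
  set g : ℕ → ℝ := fun k => (((n + 1 : ℕ) : ℝ) * ((k + n).choose (n + 1) : ℝ))⁻¹ with hg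
  have hdiff : ∀ k, 1 ≤ k → diagTerm 1 (n + 1) k = g k - g (k + 1) := by
    intro k hk
    obtain ⟨m, rfl⟩ : ∃ m, k = m + 1 := ⟨k - 1, by omega⟩
    have e1 : ((m + 1 + (n + 1) : ℕ) : ℝ) * ((m + 1 + n).choose (n + 1) : ℝ) =
        ((m + 1 + (n + 1)).choose (n + 1) : ℝ) * ((m + 1 : ℕ) : ℝ) := by
      have h1 := Nat.add_one_mul_choose_eq (m + 1 + n) m
      have h2 : (m + 1 + n).choose m = (m + 1 + n).choose (n + 1) := by
        rw [show m + 1 + n = m + (n + 1) by ring, Nat.choose_symm_add]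
      have h3 : (m + 1 + n + 1).choose (m + 1) = (m + 1 + (n + 1)).choose (n + 1) := by
        rw [show m + 1 + n + 1 = m + 1 + (n + 1) by ring, Nat.choose_symm_add]
      rw [h2, h3] at h1
      exact_mod_cast h1
    have p1 : ((m + 1 + n).choose (n + 1) : ℝ) ≠ 0 := by
      exact_mod_cast (Nat.choose_pos (by omega : n + 1 ≤ m + 1 + n)).ne'
    have p2 : ((m + 1 + (n + 1)).choose (n + 1) : ℝ) ≠ 0 := by
      exact_mod_cast (Nat.choose_pos (by omega : n + 1 ≤ m + 1 + (n + 1))).ne'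
    have hn : ((n : ℝ) + 1) ≠ 0 := by positivity
    have hm : ((m : ℝ) + 1) ≠ 0 := by positivity
    simp only [hg, diagTerm, show m + 1 + 1 + n = m + 1 + (n + 1) by ring]
    push_cast at e1 ⊢
    generalize ((m + 1 + n).choose (n + 1) : ℝ) = C at *
    generalize ((m + 1 + (n + 1)).choose (n + 1) : ℝ) = D at *
    field_simp
    linear_combination e1
  have hlim : Tendsto (fun N : ℕ => g (n + 2 + N)) atTop (𝓝 0) := by
    refine squeeze_zero (fun N => ?_) (fun N => ?_) tendsto_one_div_add_atTop_nhds_zero_nat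
    · simp only [hg]; positivity
    · simp only [hg]
      rw [one_div]
      apply inv_anti₀ (by positivity)
      have h1 : N + 1 ≤ (n + 2 + N + n).choose (n + 1) :=
        (le_choose_add (N + 1) n).trans (Nat.choose_le_choose _ (by omega))
      have h2 : N + 1 ≤ (n + 1) * (n + 2 + N + n).choose (n + 1) :=
        h1.trans (Nat.le_mul_of_pos_left _ (by omega))
      exact_mod_cast h2
  have hsum : HasSum (fun j : ℕ => diagTerm 1 (n + 1) (n + 1 + 1 + j)) (g (n + 2) - 0) := by
    rw [hasSum_iff_tendsto_nat_of_nonneg fun _ => diagTerm_nonneg _ _ _]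
    have : ∀ N, ∑ j ∈ Finset.range N, diagTerm 1 (n + 1) (n + 1 + 1 + j) =
        g (n + 2) - g (n + 2 + N) := by
      intro N
      rw [← Finset.sum_range_sub' (fun j => g (n + 2 + j)) N]
      exact Finset.sum_congr rfl fun j _ => hdiff _ (by omega)
    simp only [this]
    exact hlim.const_sub _
  rw [diagTail, hsum.tsum_eq, sub_zero]
  simp only [hg]
  rw [Nat.centralBinom, show n + 2 + n = 2 * (n + 1) by ring, mul_comm]

/-! ### Nested sums weighted by the first central binomial coefficient -/

/-- The nested sum `∑_{n₁ > ⋯ > n_{c+1} > n} binom(2n₁, n₁)⁻¹ n₁^{-b} n₂⁻¹ ⋯ n_{c+1}⁻¹`, summed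
from the outermost index `n_{c+1}`. -/
noncomputable def nestedTail (b : ℕ) : ℕ → ℕ → ℝ
  | 0, n => ∑' j : ℕ, ((Nat.centralBinom (n + 1 + j) : ℝ) * ((n + 1 + j : ℕ) : ℝ) ^ b)⁻¹
  | c + 1, n => ∑' j : ℕ, ((n + 1 + j : ℕ) : ℝ)⁻¹ * nestedTail b c (n + 1 + j)

lemma two_pow_le_centralBinom (n : ℕ) : 2 ^ n ≤ Nat.centralBinom n := by
  induction n with
  | zero => simp
  | succ n ih =>
    have h := Nat.succ_mul_centralBinom_succ n
    refine Nat.le_of_mul_le_mul_left ?_ (Nat.succ_pos n)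
    rw [Nat.succ_eq_add_one, h, pow_succ]
    nlinarith [Nat.zero_le n]

lemma hasSum_half_pow (n : ℕ) : HasSum (fun j : ℕ => (1 / 2 : ℝ) ^ (n + 1 + j)) ((1 / 2) ^ n) := by
  have h := (hasSum_geometric_two).mul_left ((1 / 2 : ℝ) ^ (n + 1))
  rw [show (1 / 2 : ℝ) ^ (n + 1) * 2 = (1 / 2) ^ n by rw [pow_succ]; ring] at h
  simpa only [← pow_add] using h

/-- The bound 2^{-n} reproduces itself under summation over indices > n, so it passes through every
level of nesting without a constant. -/
lemma summable_and_tsum_le_half_pow {n : ℕ} {f : ℕ → ℝ} (h0 : ∀ j, 0 ≤ f j)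
    (h1 : ∀ j, f j ≤ (1 / 2) ^ (n + 1 + j)) : Summable f ∧ ∑' j, f j ≤ (1 / 2) ^ n := by
  have hs := (hasSum_half_pow n).summable.of_nonneg_of_le h0 h1
  exact ⟨hs, (hs.tsum_le_tsum h1 (hasSum_half_pow n).summable).trans_eq (hasSum_half_pow n).tsum_eq⟩

lemma inv_centralBinom_mul_pow_le (b n : ℕ) :
    ((Nat.centralBinom n : ℝ) * (n : ℝ) ^ b)⁻¹ ≤ (1 / 2) ^ n := by
  rw [mul_inv, one_div, inv_pow]
  have h : (2 : ℝ) ^ n ≤ Nat.centralBinom n := by exact_mod_cast two_pow_le_centralBinom n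
  calc _ ≤ ((2 : ℝ) ^ n)⁻¹ * 1 := by
        refine mul_le_mul (inv_anti₀ (by positivity) h) ?_ (by positivity) (by positivity)
        rw [← inv_pow]
        exact pow_le_one₀ (by positivity) (Nat.cast_inv_le_one n)
    _ = _ := mul_one _

lemma nestedTail_nonneg (b c n : ℕ) : 0 ≤ nestedTail b c n := by
  induction c generalizing n with
  | zero => exact tsum_nonneg fun _ => by positivity
  | succ c ih => exact tsum_nonneg fun _ => mul_nonneg (by positivity) (ih _)

lemma summable_nestedTail_zero (b n : ℕ) : Summable fun j : ℕ =>
    ((Nat.centralBinom (n + 1 + j) : ℝ) * ((n + 1 + j : ℕ) : ℝ) ^ b)⁻¹ :=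
  (summable_and_tsum_le_half_pow (fun _ => by positivity)
    fun _ => inv_centralBinom_mul_pow_le _ _).1

lemma nestedTail_le (b c n : ℕ) : nestedTail b c n ≤ (1 / 2) ^ n := by
  induction c generalizing n with
  | zero => exact (summable_and_tsum_le_half_pow (fun _ => by positivity)
      fun _ => inv_centralBinom_mul_pow_le _ _).2
  | succ c ih =>
    exact (summable_and_tsum_le_half_pow
      (fun _ => mul_nonneg (by positivity) (nestedTail_nonneg _ _ _))
      fun _ => (mul_le_of_le_one_left (nestedTail_nonneg _ _ _) (Nat.cast_inv_le_one _)).trans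
        (ih _)).2

lemma summable_nestedTail_succ (b c n : ℕ) : Summable fun j : ℕ =>
    ((n + 1 + j : ℕ) : ℝ)⁻¹ * nestedTail b c (n + 1 + j) :=
  (summable_and_tsum_le_half_pow (fun _ => mul_nonneg (by positivity) (nestedTail_nonneg _ _ _))
    fun _ => (mul_le_of_le_one_left (nestedTail_nonneg _ _ _) (Nat.cast_inv_le_one _)).trans
      (nestedTail_le _ _ _)).1

lemma tendsto_nestedTail (b c : ℕ) : Tendsto (nestedTail b c) atTop (𝓝 0) :=
  squeeze_zero (nestedTail_nonneg b c) (nestedTail_le b c)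
    (tendsto_pow_atTop_nhds_zero_of_lt_one (by norm_num) (by norm_num))

lemma nestedTail_zero_step (b n : ℕ) : nestedTail b 0 n =
    ((Nat.centralBinom (n + 1) : ℝ) * ((n + 1 : ℕ) : ℝ) ^ b)⁻¹ + nestedTail b 0 (n + 1) := by
  rw [nestedTail, (summable_nestedTail_zero b n).tsum_eq_zero_add, nestedTail]
  simp only [add_zero, ← add_assoc, Nat.add_right_comm _ _ 1]

lemma nestedTail_succ_step (b c n : ℕ) : nestedTail b (c + 1) n =
    ((n + 1 : ℕ) : ℝ)⁻¹ * nestedTail b c (n + 1) + nestedTail b (c + 1) (n + 1) := by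
  rw [nestedTail, (summable_nestedTail_succ b c n).tsum_eq_zero_add, nestedTail]
  simp only [add_zero, ← add_assoc, Nat.add_right_comm _ _ 1]

/-! ### The identity between the two kinds of tails -/

lemma eq_of_step_of_tendsto_zero {f g : ℕ → ℝ} (hf : Tendsto f atTop (𝓝 0))
    (hg : Tendsto g atTop (𝓝 0)) (h : ∀ n, f n - f (n + 1) = g n - g (n + 1)) : f = g := by
  have hc : ∀ n, f n - g n = f 0 - g 0 := by
    intro n
    induction n with
    | zero => rfl
    | succ n ih => linarith [h n]
  have h0 : f 0 - g 0 = 0 := by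
    have h1 := hf.sub hg
    simp only [hc, sub_zero] at h1
    exact tendsto_nhds_unique tendsto_const_nhds h1
  funext n
  linarith [hc n]

/-- Raising the weight by one lengthens each string of ones by one and creates the new term b = a+1
without ones. The target is a general monoid, to serve both for the tails and for δ. -/
lemma sum_Icc_succ_sub {M : Type*} [AddCommMonoid M] (f : ℕ → ℕ → M) {a : ℕ} (ha : 2 ≤ a) :
    ∑ b ∈ Finset.Icc 3 (a + 1), f b (a + 1 - b) =
      ∑ b ∈ Finset.Icc 3 a, f b (a - b + 1) + f (a + 1) 0 := by
  rw [Finset.sum_Icc_succ_top (by omega), Nat.sub_self]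
  congr 1
  refine Finset.sum_congr rfl fun b hb => ?_
  rw [Nat.sub_add_comm (Finset.mem_Icc.1 hb).2]

theorem diagTail_eq {a : ℕ} (ha : 2 ≤ a) : diagTail a = fun n =>
    2 * ∑ b ∈ Finset.Icc 3 a, nestedTail b (a - b) n + 3 * nestedTail 2 (a - 2) n := by
  have hlim : ∀ a, Tendsto (fun n => 2 * ∑ b ∈ Finset.Icc 3 a, nestedTail b (a - b) n +
      3 * nestedTail 2 (a - 2) n) atTop (𝓝 0) := by
    intro a
    have h1 := tendsto_finsetSum (Finset.Icc 3 a) fun b _ => tendsto_nestedTail b (a - b)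
    simpa using (h1.const_mul 2).add ((tendsto_nestedTail 2 (a - 2)).const_mul 3)
  induction a, ha using Nat.le_induction with
  | base =>
    refine eq_of_step_of_tendsto_zero (tendsto_diagTail le_rfl) (hlim 2) fun n => ?_
    have h := diagTail_succ le_rfl n
    -- The coefficient 3 arises here: 2 from the initial term and 1 from the telescoped sum.
    rw [diagTail_one] at h
    simp only [show Finset.Icc 3 2 = ∅ from rfl, Finset.sum_empty, Nat.sub_self,
      nestedTail_zero_step 2 n]
    norm_num only at h
    rw [h, pow_two, mul_inv, mul_inv, mul_inv]
    ring
  | succ a ha ih =>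
    refine eq_of_step_of_tendsto_zero (tendsto_diagTail (by omega)) (hlim (a + 1)) fun n => ?_
    -- The new index b = a+1 accounts for the isolated term with its factor 2; the differences for b
    -- ≤ a add up to (n+1)⁻¹ times the identity for a at n+1.
    rw [diagTail_succ (by omega), ih,
      sum_Icc_succ_sub (fun b c => nestedTail b c n) ha,
      sum_Icc_succ_sub (fun b c => nestedTail b c (n + 1)) ha,
      show a + 1 - 2 = a - 2 + 1 by omega, nestedTail_succ_step 2, nestedTail_zero_step (a + 1) n]
    simp only [nestedTail_succ_step _ _ n, Finset.sum_add_distrib, ← Finset.mul_sum]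
    ring

open MeasureTheory

/-! ### Iterated integrals as power series -/

/-- By nonnegativity the integrals of the norms are the c_j themselves, so their summability
justifies integrating term by term. The expansion is required only on the open interval, since the
forms are singular at 0 and 1. -/
lemma hasSum_integral_of_nonneg {x : ℝ} (hx : 0 ≤ x) {F : ℕ → ℝ → ℝ} {c : ℕ → ℝ} {g : ℝ → ℝ}
    (hF : ∀ j, Continuous (F j)) (h0 : ∀ j, ∀ t ∈ Set.Ioo 0 x, 0 ≤ F j t)
    (hc : ∀ j, ∫ t in (0 : ℝ)..x, F j t = c j) (hs : Summable c)
    (hg : ∀ t ∈ Set.Ioo 0 x, HasSum (fun j => F j t) (g t)) :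
    HasSum c (∫ t in (0 : ℝ)..x, g t) := by
  have hint : ∀ f : ℝ → ℝ, ∫ t in (0 : ℝ)..x, f t = ∫ t in Set.Ioo 0 x, f t := fun f => by
    rw [intervalIntegral.integral_of_le hx, integral_Ioc_eq_integral_Ioo]
  have hFi : ∀ j, Integrable (F j) (volume.restrict (Set.Ioo 0 x)) := fun j =>
    ((hF j).integrableOn_Icc (a := 0) (b := x)).mono_set Set.Ioo_subset_Icc_self
  have hn : ∀ j, ∫ t in Set.Ioo 0 x, ‖F j t‖ = c j := fun j => by
    rw [← hc j, hint]
    exact setIntegral_congr_fun measurableSet_Ioo fun t ht => Real.norm_of_nonneg (h0 j t ht)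
  have h := hasSum_integral_of_summable_integral_norm hFi (by simpa only [hn] using hs)
  simp only [← hint, hc] at h
  rwa [hint, setIntegral_congr_fun measurableSet_Ioo fun t ht => (hg t ht).tsum_eq, ← hint] at h

/-- Each integration raises the exponent of the denominator by one; `d` is kept free to match the
cast of n+1+j. -/
lemma integral_pow_div (m i : ℕ) (x d : ℝ) (hd : d = m + 1) :
    ∫ t in (0 : ℝ)..x, t ^ m / d ^ i = x ^ (m + 1) / d ^ (i + 1) := by
  subst hd
  rw [intervalIntegral.integral_div, integral_pow, zero_pow (by omega), sub_zero, div_div,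
    ← pow_succ']

/-- The iterated integral attached to the word `0^i 1` is a polylogarithm tail. -/
lemma hasSum_iterInt (n i : ℕ) {x : ℝ} (hx0 : 0 ≤ x) (hx1 : x < 1) :
    HasSum (fun j : ℕ => x ^ (n + j + 1) / ((n + 1 + j : ℕ) : ℝ) ^ (i + 1))
      (iterInt n (List.replicate i false ++ [true]) x) := by
  have hsum : Summable (fun j : ℕ => x ^ (n + j + 1) / ((n + 1 + j : ℕ) : ℝ) ^ (i + 1)) := by
    refine (summable_geometric_of_lt_one hx0 hx1).of_nonneg_of_le (fun _ => by positivity)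
      fun j => ?_
    have h1 : (1 : ℝ) ≤ ((n + 1 + j : ℕ) : ℝ) ^ (i + 1) :=
      one_le_pow₀ (by exact_mod_cast (by omega : 1 ≤ n + 1 + j))
    exact (div_le_self (by positivity) h1).trans (pow_le_pow_of_le_one hx0 hx1.le (by omega))
  induction i generalizing x with
  | zero =>
    refine hasSum_integral_of_nonneg (F := fun j t => t ^ (n + j) / ((n + 1 + j : ℕ) : ℝ) ^ 0) hx0
      (fun j => by fun_prop) (fun j t ht => by have := ht.1; positivity)
      (fun j => integral_pow_div _ _ _ _ (by push_cast; ring)) hsum fun t ht => ?_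
    have h := (hasSum_geometric_of_lt_one ht.1.le (ht.2.trans hx1)).mul_right (t ^ n)
    simp only [form, iterInt, one_div]
    simpa only [pow_zero, div_one, pow_add, mul_comm] using h
  | succ i ih =>
    refine hasSum_integral_of_nonneg
      (F := fun j t => t ^ (n + j) / ((n + 1 + j : ℕ) : ℝ) ^ (i + 1)) hx0
      (fun j => by fun_prop) (fun j t ht => by have := ht.1; positivity)
      (fun j => integral_pow_div _ _ _ _ (by push_cast; ring)) hsum fun t ht => ?_
    have ht1 := ht.2.trans hx1
    -- Summability depends on `i` and `x`, so the induction made it a hypothesis of `ih`; it has to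
    -- be supplied at `t`.
    have hsum' : Summable (fun j : ℕ => t ^ (n + j + 1) / ((n + 1 + j : ℕ) : ℝ) ^ (i + 1)) := by
      refine (summable_geometric_of_lt_one ht.1.le ht1).of_nonneg_of_le
        (fun _ => by have := ht.1; positivity) fun j => ?_
      have h1 : (1 : ℝ) ≤ ((n + 1 + j : ℕ) : ℝ) ^ (i + 1) :=
        one_le_pow₀ (by exact_mod_cast (by omega : 1 ≤ n + 1 + j))
      exact (div_le_self (by have := ht.1; positivity) h1).trans
        (pow_le_pow_of_le_one ht.1.le ht1.le (by omega))
    have h := (ih ht.1.le ht1 hsum').mul_left (1 / t)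
    have ht0 : t ≠ 0 := ht.1.ne'
    have e : ∀ j, 1 / t * (t ^ (n + j + 1) / ((n + 1 + j : ℕ) : ℝ) ^ (i + 1)) =
        t ^ (n + j) / ((n + 1 + j : ℕ) : ℝ) ^ (i + 1) := fun j => by
      rw [pow_succ t]
      field_simp
    simp only [e] at h
    exact h

/-- The Beta integral, by induction on n for all m: one factor 1 - t is expanded, which leaves two
integrals of lower n. -/
lemma integral_one_sub_pow_mul_pow (n m : ℕ) :
    ∫ t in (0 : ℝ)..1, (1 - t) ^ n * t ^ m = (((m + 1 + n).choose n : ℝ) * ((m : ℝ) + 1))⁻¹ := by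
  induction n generalizing m with
  | zero => simp [integral_pow]
  | succ n ih =>
    have h : ∀ t : ℝ, (1 - t) ^ (n + 1) * t ^ m = (1 - t) ^ n * t ^ m - (1 - t) ^ n * t ^ (m + 1) :=
      fun t => by ring
    simp only [h]
    rw [intervalIntegral.integral_sub (Continuous.intervalIntegrable (by fun_prop) _ _)
      (Continuous.intervalIntegrable (by fun_prop) _ _), ih, ih]
    -- Both other binomial coefficients are expressed through binom(m+1+n, n).
    have e1 : ((m + 1 + n + 1 : ℕ) : ℝ) * ((m + 1 + n).choose n : ℝ) =
        ((m + 1 + (n + 1)).choose (n + 1) : ℝ) * ((n + 1 : ℕ) : ℝ) := by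
      exact_mod_cast Nat.add_one_mul_choose_eq (m + 1 + n) n
    have e2 : ((m + 1 + n + 1 : ℕ) : ℝ) * ((m + 1 + n).choose n : ℝ) =
        ((m + 1 + 1 + n).choose n : ℝ) * ((m + 1 + 1 : ℕ) : ℝ) := by
      have h1 := Nat.add_one_mul_choose_eq (m + 1 + n) (m + 1)
      rw [Nat.choose_symm_add, show m + 1 + n + 1 = m + 1 + 1 + n by ring, Nat.choose_symm_add,
        show m + 1 + 1 + n = m + 1 + n + 1 by ring] at h1
      rw [show m + 1 + 1 + n = m + 1 + n + 1 by ring]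
      exact_mod_cast h1
    have p1 : ((m + 1 + n).choose n : ℝ) ≠ 0 := by
      exact_mod_cast (Nat.choose_pos (by omega : n ≤ m + 1 + n)).ne'
    have p2 : ((m + 1 + (n + 1)).choose (n + 1) : ℝ) ≠ 0 := by
      exact_mod_cast (Nat.choose_pos (by omega : n + 1 ≤ m + 1 + (n + 1))).ne'
    have p3 : ((m + 1 + 1 + n).choose n : ℝ) ≠ 0 := by
      exact_mod_cast (Nat.choose_pos (by omega : n ≤ m + 1 + 1 + n)).ne'
    push_cast at e1 e2 ⊢
    generalize ((m + 1 + n).choose n : ℝ) = C at *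
    generalize ((m + 1 + (n + 1)).choose (n + 1) : ℝ) = D at *
    generalize ((m + 1 + 1 + n).choose n : ℝ) = G at *
    have hm : (m : ℝ) + 1 ≠ 0 := by positivity
    have hm2 : (m : ℝ) + 1 + 1 ≠ 0 := by positivity
    have hn : (n : ℝ) + 1 ≠ 0 := by positivity
    have hD : D = (m + 1 + n + 1) * C / (n + 1) := by field_simp; linear_combination -e1
    have hG : G = (m + 1 + n + 1) * C / (m + 1 + 1) := by field_simp; linear_combination -e2
    have hmn : (m : ℝ) + 1 + n + 1 ≠ 0 := by positivity
    rw [hD, hG]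
    field_simp
    ring

/-- Reindexing of the integers `> n`. -/
def natEquivIoi (n : ℕ) : ℕ ≃ Set.Ioi n where
  toFun j := ⟨n + 1 + j, by simp only [Set.mem_Ioi]; omega⟩
  invFun k := k.1 - (n + 1)
  left_inv j := by simp
  right_inv k := by
    have := k.2
    simp only [Set.mem_Ioi] at this
    apply Subtype.ext
    simp only
    omega

/-- The word of (a) is 0^{a-1}1. All letters but the outermost give the power series of
`hasSum_iterInt`; the outermost integration, against (1-t)^n / t, turns each power of t into a Beta
integral. -/
theorem hasSum_zetaDoubleTail {a : ℕ} (ha : 2 ≤ a) (n : ℕ) :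
    HasSum (fun j : ℕ => diagTerm a n (n + 1 + j)) (zetaDoubleTail [a] n n) := by
  obtain ⟨i, rfl⟩ : ∃ i, a = i + 2 := ⟨a - 2, by omega⟩
  have hw : word [i + 2] = false :: (List.replicate i false ++ [true]) := by
    simp [word, List.replicate_succ]
  rw [zetaDoubleTail, hw]
  refine hasSum_integral_of_nonneg
    (F := fun j t => (1 - t) ^ n * t ^ (n + j) / ((n + 1 + j : ℕ) : ℝ) ^ (i + 1)) zero_le_one
    (fun j => by fun_prop) (fun j t ht => ?_) (fun j => ?_)
    (summable_diagTerm (Or.inl ha)) fun t ht => ?_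
  · have h1 := ht.1
    have h2 := sub_pos.2 ht.2
    positivity
  · have e : ((n + j : ℕ) : ℝ) + 1 = ((n + 1 + j : ℕ) : ℝ) := by push_cast; ring
    rw [intervalIntegral.integral_div, integral_one_sub_pow_mul_pow, diagTerm, e,
      show n + j + 1 + n = n + 1 + j + n by ring, div_eq_mul_inv, ← mul_inv, mul_assoc,
      ← pow_succ']
  · have h := (hasSum_iterInt n i ht.1.le ht.2).mul_left ((1 - t) ^ n * form false t)
    have ht0 : t ≠ 0 := ht.1.ne'
    have e : ∀ j, (1 - t) ^ n * form false t *
        (t ^ (n + j + 1) / ((n + 1 + j : ℕ) : ℝ) ^ (i + 1)) =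
        (1 - t) ^ n * t ^ (n + j) / ((n + 1 + j : ℕ) : ℝ) ^ (i + 1) := fun j => by
      rw [form, pow_succ t]
      field_simp
    simpa only [e] using h

/-! ### Sums over decreasing tuples as nested sums -/

lemma strictAnti_snoc {r m : ℕ} {w : Fin (r + 1) → ℕ} (hw : StrictAnti w) (h : ∀ i, m < w i) :
    StrictAnti (Fin.snoc w m : Fin (r + 2) → ℕ) := by
  intro i j hij
  induction j using Fin.lastCases with
  | last =>
    induction i using Fin.lastCases with
    | last => exact absurd hij (lt_irrefl _)
    | cast i => simpa using h i
  | cast j =>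
    induction i using Fin.lastCases with
    | last => exact absurd hij (not_lt.2 (Fin.le_last _))
    | cast i => simpa using hw (Fin.castSucc_lt_castSucc_iff.1 hij)

/-- A decreasing tuple of length one is an integer. -/
def decrTupleOneEquiv (n : ℕ) : Set.Ioi n ≃ DecrTuple 1 n where
  toFun k := ⟨fun _ => k.1, fun i j h => absurd h (by simp [Subsingleton.elim i j]), fun _ => k.2⟩
  invFun v := ⟨v.1 0, v.2.2 0⟩
  left_inv _ := rfl
  right_inv v := Subtype.ext (funext fun i => congrArg v.1 (Subsingleton.elim _ _))

/-- A decreasing tuple amounts to its last entry and the preceding entries. -/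
def decrTupleSnocEquiv (r n : ℕ) :
    (Σ k : Set.Ioi n, DecrTuple (r + 1) k.1) ≃ DecrTuple (r + 2) n where
  toFun p := ⟨Fin.snoc p.2.1 p.1.1, strictAnti_snoc p.2.2.1 p.2.2.2, fun i => by
    induction i using Fin.lastCases with
    | last => rw [Fin.snoc_last]; exact p.1.2
    | cast i => rw [Fin.snoc_castSucc]; exact lt_trans p.1.2 (p.2.2.2 i)⟩
  invFun v := ⟨⟨v.1 (Fin.last _), v.2.2 _⟩, ⟨Fin.init v.1,
    fun _ _ h => v.2.1 (Fin.castSucc_lt_castSucc_iff.2 h),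
    fun i => v.2.1 (Fin.castSucc_lt_last i)⟩⟩
  left_inv p := by
    obtain ⟨⟨k, hk⟩, ⟨w, hw⟩⟩ := p
    have e : (Fin.snoc w k : Fin (r + 2) → ℕ) (Fin.last _) = k := Fin.snoc_last _ _
    have e' : Fin.init (Fin.snoc w k : Fin (r + 2) → ℕ) = w := Fin.init_snoc _ _
    simp only [e']
    congr 1
    · exact Subtype.ext e
    -- The two tuples have types that depend on their lower bounds, which `e` identifies.
    · congr 1 <;> simp [e]
  right_inv v := Subtype.ext (Fin.snoc_init_self v.1)

/-- The term `binom(2n₁, n₁)⁻¹ n₁^{-b} n₂⁻¹ ⋯ n_{c+1}⁻¹`. -/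
noncomputable def onesTerm (b c : ℕ) (v : Fin (c + 1) → ℕ) : ℝ :=
  ((Nat.centralBinom (v 0) : ℝ) * (v 0 : ℝ) ^ b)⁻¹ * ∏ i : Fin c, (v i.succ : ℝ)⁻¹

lemma onesTerm_nonneg (b c : ℕ) (v : Fin (c + 1) → ℕ) : 0 ≤ onesTerm b c v :=
  mul_nonneg (by positivity) (Finset.prod_nonneg fun _ _ => by positivity)

lemma onesTerm_snoc (b c k : ℕ) (w : Fin (c + 1) → ℕ) :
    onesTerm b (c + 1) (Fin.snoc w k : Fin (c + 2) → ℕ) = (k : ℝ)⁻¹ * onesTerm b c w := by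
  have h0 : (Fin.snoc w k : Fin (c + 2) → ℕ) 0 = w 0 := Fin.snoc_castSucc (α := fun _ => ℕ) k w 0
  have h1 : ∀ i : Fin c, (Fin.snoc w k : Fin (c + 2) → ℕ) i.castSucc.succ = w i.succ := fun i => by
    rw [Fin.succ_castSucc]; exact Fin.snoc_castSucc (α := fun _ => ℕ) k w i.succ
  have h2 : (Fin.snoc w k : Fin (c + 2) → ℕ) (Fin.last c).succ = k := by
    rw [Fin.succ_last]; exact Fin.snoc_last (α := fun _ => ℕ) k w
  rw [onesTerm, onesTerm, Fin.prod_univ_castSucc, h0, h2]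
  simp only [h1]
  ring

/-- Tuples are fibred over their smallest entry k, which contributes the factor k⁻¹. As all terms
are nonnegative, summability of the iterated sums gives that of the whole family. -/
theorem hasSum_onesTerm (b c n : ℕ) :
    HasSum (fun v : DecrTuple (c + 1) n => onesTerm b c v.1) (nestedTail b c n) := by
  induction c generalizing n with
  | zero =>
    rw [← ((natEquivIoi n).trans (decrTupleOneEquiv n)).hasSum_iff]
    refine (summable_nestedTail_zero b n).hasSum.congr_fun fun j => ?_
    simp [onesTerm, natEquivIoi, decrTupleOneEquiv]
  | succ c ih =>
    have hfib : ∀ k : Set.Ioi n, HasSum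
        (fun w : DecrTuple (c + 1) k.1 => onesTerm b (c + 1) (decrTupleSnocEquiv c n ⟨k, w⟩).1)
        ((k.1 : ℝ)⁻¹ * nestedTail b c k.1) := fun k => by
      have h := (ih k.1).mul_left (k.1 : ℝ)⁻¹
      simp only [← onesTerm_snoc] at h
      exact h
    have hout : HasSum (fun k : Set.Ioi n => (k.1 : ℝ)⁻¹ * nestedTail b c k.1)
        (nestedTail b (c + 1) n) := by
      rw [← (natEquivIoi n).hasSum_iff]
      exact (summable_nestedTail_succ b c n).hasSum
    rw [← (decrTupleSnocEquiv c n).hasSum_iff]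
    refine HasSum.sigma_of_hasSum hout hfib ?_
    refine (summable_sigma_of_nonneg fun _ => onesTerm_nonneg _ _ _).2
      ⟨fun k => (hfib k).summable, ?_⟩
    exact hout.summable.congr fun k => (hfib k).tsum_eq.symm

lemma aperyTerm_eq_onesTerm (b : ℕ) {l : List ℕ} (hl : ∀ x ∈ l, x = 1)
    (v : Fin (l.length + 1) → ℕ) : aperyTerm b l v = onesTerm b l.length v := by
  rw [aperyTerm, zetaTerm, onesTerm]
  change _ * ∏ i : Fin (l.length + 1), _ = _
  rw [Fin.prod_univ_succ, ← mul_assoc, ← mul_inv]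
  congr 1
  refine Finset.prod_congr rfl fun i _ => ?_
  have : (b :: l).get i.succ = 1 := hl _ (List.get_mem l i)
  rw [this, pow_one]

theorem hasSum_aperyTerm (b c n : ℕ) :
    HasSum (fun v : DecrTuple ((List.replicate c 1).length + 1) n =>
      aperyTerm b (List.replicate c 1) v.1) (nestedTail b c n) := by
  have h := hasSum_onesTerm b (List.replicate c 1).length n
  simp only [← aperyTerm_eq_onesTerm b fun x hx => List.eq_of_mem_replicate hx] at h
  -- Only the value of the sum is rewritten: the type of the tuples keeps the length of the
  -- replicated list.
  rwa [congrArg (nestedTail b · n) (List.length_replicate : (List.replicate c 1).length = c)] at h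

lemma aperyTail_eq (b c n : ℕ) : aperyTail (b :: List.replicate c 1) n = nestedTail b c n :=
  (hasSum_aperyTerm b c n).tsum_eq

theorem hasSum_zetaTerm {a : ℕ} (ha : 2 ≤ a) :
    HasSum (fun v : DecrTuple [a].length 0 => zetaTerm [a] v.1) (diagTail a 0) := by
  refine ((natEquivIoi 0).trans (decrTupleOneEquiv 0)).hasSum_iff.1 ?_
  have h : HasSum _ (diagTail a 0) := (summable_diagTerm (Or.inl ha)).hasSum
  simp only [diagTerm, Nat.choose_zero_right, Nat.cast_one, one_mul] at h
  have e : ∀ v : Fin [a].length → ℕ, zetaTerm [a] v = ((v 0 : ℝ) ^ a)⁻¹ := fun v => by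
    simp [zetaTerm]
  simp only [Function.comp_def, e]
  exact h

/-! ### The value of `δ` in depth one -/

lemma basis_mapDomain (f : AdmComp → AdmComp) (a : AdmComp) :
    (basis a).mapDomain f = basis (f a) := Finsupp.mapDomain_single

lemma appendTo_init {b : AdmComp} (h : b ≠ AdmComp.empty) :
    appendTo b.weight b.init = b := by
  obtain ⟨x, hx, e⟩ := AdmComp.exists_init_append h
  have hw : b.weight = b.init.weight + x := by
    rw [AdmComp.weight, e]; simp [AdmComp.weight]
  apply Subtype.ext
  rw [appendTo, dif_pos ⟨AdmComp.weight_init_lt h, AdmComp.two_le_weight h⟩, e]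
  simp [hw]

/-- As δ preserves the weight, the deleted last entry is determined by what remains, and `appendTo`
undoes init on δ([a]). The defining relation thus becomes a recursion. -/
lemma delta_cls {a : AdmComp} (h : a ≠ AdmComp.empty) : delta (cls a) =
    (delta (cls a.init + cls a.mid + cls a.fin)).mapDomain (appendTo a.weight) := by
  rw [← isDelta_delta.map_init a h, initMap, Finsupp.lmapDomain_apply, ← Finsupp.mapDomain_comp]
  conv_lhs => rw [← Finsupp.mapDomain_id (v := delta (cls a))]
  refine Finsupp.mapDomain_congr fun b hb => ?_
  have hw := isDelta_delta.graded a b hb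
  have hb0 : b ≠ AdmComp.empty := by
    rintro rfl
    have := AdmComp.two_le_weight h
    simp [AdmComp.empty, AdmComp.weight] at hw this
    omega
  rw [← hw, Function.comp_apply, appendTo_init hb0, id]

lemma init_depthOne (a : ℕ) (ha : 2 ≤ a) :
    (AdmComp.depthOne a ha).init = AdmComp.empty := rfl

lemma fin_depthOne_two : (AdmComp.depthOne 2 le_rfl).fin = AdmComp.empty :=
  Subtype.ext (by rw [AdmComp.fin_val]; rfl)

/-- The dual of (a+1) is (2, 1, …, 1) with a-1 ones; deleting the last one gives the dual of (a). -/
lemma fin_depthOne_succ (a : ℕ) (ha : 2 ≤ a) :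
    (AdmComp.depthOne (a + 1) (by omega)).fin = AdmComp.depthOne a ha :=
  Subtype.ext (by
    rw [AdmComp.fin_val]
    simp only [AdmComp.depthOne, AdmComp.finList]
    rw [if_pos (by omega), Nat.add_sub_cancel])

lemma depthOne_ne_empty (a : ℕ) (ha : 2 ≤ a) : AdmComp.depthOne a ha ≠ AdmComp.empty :=
  fun h => by simpa [AdmComp.depthOne, AdmComp.empty] using congrArg Subtype.val h

lemma weight_depthOne (a : ℕ) (ha : 2 ≤ a) : (AdmComp.depthOne a ha).weight = a := by
  simp [AdmComp.depthOne, AdmComp.weight]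

lemma appendTo_empty (a : ℕ) (ha : 2 ≤ a) :
    appendTo a AdmComp.empty = AdmComp.consOnes a 0 ha := by
  have h0 : AdmComp.empty.weight = 0 := rfl
  apply Subtype.ext
  rw [appendTo, dif_pos ⟨by omega, ha⟩]
  simp only [h0]
  rfl

lemma appendTo_consOnes (b c : ℕ) (hb : 2 ≤ b) :
    appendTo (b + c + 1) (AdmComp.consOnes b c hb) = AdmComp.consOnes b (c + 1) hb := by
  have h0 : (AdmComp.consOnes b c hb).weight = b + c := by
    simp [AdmComp.weight, AdmComp.consOnes]
  apply Subtype.ext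
  rw [appendTo, dif_pos ⟨by omega, by omega⟩]
  simp only [h0]
  simp [AdmComp.consOnes, List.replicate_succ']

/-- `basis (b, 1, …, 1)`, extended by zero to `b < 2`. -/
noncomputable def basisConsOnes (b c : ℕ) : AdmComp →₀ ℤ :=
  if hb : 2 ≤ b then basis (AdmComp.consOnes b c hb) else 0

lemma basisConsOnes_of_le {b : ℕ} (c : ℕ) (hb : 2 ≤ b) :
    basisConsOnes b c = basis (AdmComp.consOnes b c hb) := dif_pos hb

lemma mapDomain_basisConsOnes {a b : ℕ} (hb : 2 ≤ b) (hba : b ≤ a) :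
    (basisConsOnes b (a - b)).mapDomain (appendTo (a + 1)) = basisConsOnes b (a - b + 1) := by
  rw [basisConsOnes_of_le _ hb, basisConsOnes_of_le _ hb, basis_mapDomain]
  conv_lhs => rw [show a + 1 = b + (a - b) + 1 by omega]
  rw [appendTo_consOnes]

theorem delta_depthOne (a : ℕ) (ha : 2 ≤ a) : delta (cls (AdmComp.depthOne a ha)) =
    2 • ∑ b ∈ Finset.Icc 3 a, basisConsOnes b (a - b) + 3 • basisConsOnes 2 (a - 2) := by
  induction a, ha using Nat.le_induction with
  | base =>
    rw [delta_cls (depthOne_ne_empty _ _), AdmComp.mid, fin_depthOne_two, init_depthOne,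
      weight_depthOne, show AdmComp.empty.init = AdmComp.empty from rfl, map_add, map_add,
      isDelta_delta.map_empty, Finsupp.mapDomain_add, Finsupp.mapDomain_add, basis_mapDomain,
      appendTo_empty 2 le_rfl, show Finset.Icc 3 2 = ∅ from rfl, Finset.sum_empty, Nat.sub_self,
      basisConsOnes_of_le _ le_rfl]
    abel
  | succ a ha ih =>
    have hsum : (∑ b ∈ Finset.Icc 3 a, basisConsOnes b (a - b)).mapDomain (appendTo (a + 1)) =
        ∑ b ∈ Finset.Icc 3 a, basisConsOnes b (a - b + 1) := by
      rw [Finsupp.mapDomain_finsetSum]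
      refine Finset.sum_congr rfl fun b hb => ?_
      rw [Finset.mem_Icc] at hb
      exact mapDomain_basisConsOnes (by omega) hb.2
    -- The empty init and mid parts each contribute (a+1). In the contribution of the final part
    -- (a), every composition has weight a, so the appended entry is 1.
    rw [delta_cls (depthOne_ne_empty _ _), AdmComp.mid, fin_depthOne_succ a ha, init_depthOne,
      init_depthOne, weight_depthOne, map_add, map_add, isDelta_delta.map_empty, ih,
      sum_Icc_succ_sub basisConsOnes ha, show a + 1 - 2 = a - 2 + 1 by omega]
    simp only [Finsupp.mapDomain_add, Finsupp.mapDomain_smul, hsum,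
      mapDomain_basisConsOnes le_rfl ha, basis_mapDomain]
    rw [appendTo_empty (a + 1) (by omega), basisConsOnes_of_le 0 (by omega : 2 ≤ a + 1)]
    abel

end AperyLike

theorem mainTheorem11 (a : ℕ) (ha : 2 ≤ a) :
    -- the value of `δ([a])`
    AperyLike.delta (AperyLike.cls (AperyLike.AdmComp.depthOne a ha)) =
        2 • ∑ b : Finset.Icc 3 a, AperyLike.basis
            (AperyLike.AdmComp.consOnes b (a - b)
              (le_trans (by norm_num) (Finset.mem_Icc.1 b.2).1))
          + 3 • AperyLike.basis (AperyLike.AdmComp.consOnes 2 (a - 2) le_rfl) ∧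
    -- convergence of the series involved
    Summable (fun v : AperyLike.DecrTuple [a].length 0 => AperyLike.zetaTerm [a] v.1) ∧
    (∀ b ∈ Finset.Icc 2 a, ∀ n : ℕ, Summable
      (fun v : AperyLike.DecrTuple ((List.replicate (a - b) 1).length + 1) n =>
        AperyLike.aperyTerm b (List.replicate (a - b) 1) v.1)) ∧
    -- the identity for `ζ(a)`
    AperyLike.mzv [a] =
        2 * ∑ b ∈ Finset.Icc 3 a, AperyLike.aperySum (b :: List.replicate (a - b) 1)
          + 3 * AperyLike.aperySum (2 :: List.replicate (a - 2) 1) ∧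
    -- the identity for the symmetric double tails of `ζ(a)`, and their series expression
    ∀ n : ℕ,
      AperyLike.zetaDoubleTail [a] n n =
        2 * ∑ b ∈ Finset.Icc 3 a, AperyLike.aperyTail (b :: List.replicate (a - b) 1) n
          + 3 * AperyLike.aperyTail (2 :: List.replicate (a - 2) 1) n ∧
      HasSum (fun k : Set.Ioi n => (((k.1 + n).choose n : ℝ) * (k.1 : ℝ) ^ a)⁻¹)
        (AperyLike.zetaDoubleTail [a] n n) := by

  have hdiag := AperyLike.diagTail_eq ha
  have hdouble : ∀ n, AperyLike.zetaDoubleTail [a] n n = AperyLike.diagTail a n := fun n =>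
    (AperyLike.hasSum_zetaDoubleTail ha n).tsum_eq.symm
  refine ⟨?_, (AperyLike.hasSum_zetaTerm ha).summable,
    fun b _ n => (AperyLike.hasSum_aperyTerm b (a - b) n).summable, ?_, fun n => ⟨?_, ?_⟩⟩
  -- The statement sums over a subtype because `consOnes` needs a proof of 2 ≤ b; `basisConsOnes`
  -- avoids this by its value 0 elsewhere.
  · rw [AperyLike.delta_depthOne, AperyLike.basisConsOnes_of_le _ le_rfl, ← Finset.sum_coe_sort]
    congr 2
    exact Finset.sum_congr rfl fun b _ => AperyLike.basisConsOnes_of_le _ _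
  · simp only [AperyLike.aperySum, AperyLike.aperyTail_eq]
    rw [AperyLike.mzv, (AperyLike.hasSum_zetaTerm ha).tsum_eq, hdiag]
  · simp only [AperyLike.aperyTail_eq, hdouble, hdiag]
  · rw [← (AperyLike.natEquivIoi n).hasSum_iff]
    exact AperyLike.hasSum_zetaDoubleTail ha n
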